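/- Let $\Gamma$ be the unit circle in the plane. For points $A,B,C\in\Gamma$ (not necessarily distinct), $M\in\Gamma$ and real $\lambda$ put $f(M,\lambda)=MA^\lambda+MB^\lambda+MC^\lambda$, where $MA$ denotes the Euclidean distance and $0^0=1$; when $\lambda<0$, $M$ ranges only over the points of $\Gamma$ other than $A,B,C$ (where $f$ is infinite). Then for all $A,B,C\in\Gamma$: 1. If $\lambda<0$, there is $M$ with $f(M,\lambda)\le 2+2^\lambda$. 2. If $\lambda\in[0,2]$, there is $M$ with $f(M,\lambda)\ge 2+2^\lambda$. 3. If $\lambda\in(2,4)$, there is $M$ with $f(M,\lambda)\ge 2(\sqrt3)^\lambda$. 4. If $\lambda\ge4$, there is $M$ with $f(M,\lambda)\ge 2+2^\lambda$. For $\lambda\ne0$ the bound is sharp for the triple $A,B,C$ (that is, it equals $\min_{M}f(M,\lambda)$ in case 1 and $\max_{M}f(M,\lambda)$ in cases 2–4) if and only if $A,B,C$ are the vertices of an equilateral triangle; for $\lambda=0$ it is sharp for every triple, as $f(M,0)=3=2+2^0$ for all $M$. Moreover, all the following minima and maxima exist and $$\min_{A,B,C\in\Gamma}\max_{M\in\Gamma}f(M,\lambda)=2+2^\lambda\quad\text{for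 }\lambda\in[0,2]\cup[4,\infty),$$ $$\min_{A,B,C\in\Gamma}\max_{M\in\Gamma}f(M,\lambda)=2(\sqrt3)^\lambda\quad\text{for }\lambda\in(2,4),$$ $$\max_{A,B,C\in\Gamma}\ \min_{M\in\Gamma\setminus\{A,B,C\}}f(M,\lambda)=2+2^\lambda\quad\text{for }\lambda<0.$$ -/

import Mathlib

/-- `f(M, s) = MA^s + MB^s + MC^s` for points of the unit circle in the plane `ℂ`, where `MA` is the
Euclidean distance (chord length). For `s < 0` this represents the sum only when `M` is none of
`A`, `B`, `C`; for `s = 0` each of the three terms is `1`. -/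
noncomputable def powerSum (A B C M : Circle) (s : ℝ) : ℝ :=
  dist (M : ℂ) (A : ℂ) ^ s + dist (M : ℂ) (B : ℂ) ^ s + dist (M : ℂ) (C : ℂ) ^ s

/-- The set of values `f(M, s)` as `M` runs over the whole unit circle (used for `0 ≤ s`). -/
def valuesOnCircle (A B C : Circle) (s : ℝ) : Set ℝ :=
  {y | ∃ M : Circle, powerSum A B C M s = y}

/-- The set of finite values `f(M, s)`, with `M` running over the points of the unit circle other
than `A`, `B`, `C` (used for `s < 0`, where the sum is infinite at `A`, `B` and `C`). -/
def valuesOffPoints (A B C : Circle) (s : ℝ) : Set ℝ :=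
  {y | ∃ M : Circle, M ≠ A ∧ M ≠ B ∧ M ≠ C ∧ powerSum A B C M s = y}

/-- `A`, `B`, `C` are the vertices of a (nondegenerate) equilateral triangle. -/
def IsEquilateralTriple (A B C : Circle) : Prop :=
  ∃ T : Affine.Triangle ℝ ℂ, T.points = ![(A : ℂ), (B : ℂ), (C : ℂ)] ∧ T.Equilateral

/-- The maximum of `f(M, s)` over `M` exists for every triple `A`, `B`, `C` on the unit circle, and
the minimum over all triples of these maxima exists and equals `v`. -/
def MinMaxEq (s v : ℝ) : Prop :=
  (∀ A B C : Circle, ∃ m : ℝ, IsGreatest (valuesOnCircle A B C s) m) ∧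
    IsLeast {m : ℝ | ∃ A B C : Circle, IsGreatest (valuesOnCircle A B C s) m} v

/-- For negative `s`: the minimum of `f(M, s)` over `M` exists for every triple `A`, `B`, `C` on the
unit circle, and the maximum over all triples of these minima exists and equals `v`. -/
def MaxMinEq (s v : ℝ) : Prop :=
  (∀ A B C : Circle, ∃ m : ℝ, IsLeast (valuesOffPoints A B C s) m) ∧
    IsGreatest {m : ℝ | ∃ A B C : Circle, IsLeast (valuesOffPoints A B C s) m} v

/-! Write `m = s / 2` and let `chordSq M A = MA ^ 2`, so that `f(M, s)` is a sum of three values of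
the function `x ^ m` on `[0, 4]`. A triple on the unit circle is equilateral if and only if
`A + B + C = 0`, and everything follows from two facts.

*Equilateral triples.* If `A + B + C = 0`, then `MA ^ 2 + MB ^ 2 + MC ^ 2 = 6` and
`MA ^ 4 + MB ^ 4 + MC ^ 4 = 18` for every `M` (`chordSq_moments`), so a quadratic polynomial has the
same sum at the three squared distances for all `M`. Comparing `x ^ m` with its quadratic Hermite
interpolant shows that the extremum of `f` is attained where the squared distances are the
interpolation nodes: `1, 1, 4` (the antipode of a vertex) or, for `2 ≤ s ≤ 4`, the nodes `0, 3, 3`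
(a vertex). The sign of the interpolation error is that of the third derivative of `x ^ m` up to a
constant factor; see `nonpos_of_double_zero`.

*All other triples.* If `A + B + C ≠ 0` and `s ≠ 0`, some `M` is strictly better than the claimed
bound.
* For `s < 0` and for `0 < s < 2`, `M` is the midpoint of the largest of the three arcs. Its squared
  distances `v, v, b` satisfy `v > 1`, `b ≥ 2` and `2 * v + b ≥ 6` (`hasFarMidpoint`), and concavity
  (convexity for `s < 0`) of `x ^ m` does the rest. Square roots `a`, `b`, `c` of the points as complex
  numbers replace the half-angles: the midpoints of the arcs are `± a * b`, `± b * c`, `± c * a`.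
* For `s ≥ 2` and the bound `2 + 2 ^ s`, `M` is an antipode of one of the points: averaging over the
  three antipodes and Bernoulli's inequality suffice, because `|A + B + C| > 0`.
* For `2 < s < 4` and the bound `2 * √3 ^ s`, `M` is an antipode if the two inner products of some
  point with the others have sum at least `0`. Otherwise the vanishing of the Gram determinant of three
  plane vectors provides a vertex whose squared distances to the two others have sum at least `6`, and
  Bernoulli's inequality applies again.

Minima and maxima over `M` exist by compactness, for `s < 0` after removing neighbourhoods of `A`, `B`
and `C`. -/

/-! ### Power functions and quadratic interpolation -/

/-- Real powers with nonpositive exponent are convex on the positive half-line. -/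
lemma convexOn_rpow_of_nonpos {p : ℝ} (hp : p ≤ 0) :
    ConvexOn ℝ (Set.Ioi 0) fun x : ℝ => x ^ p := by
  have hlog : ConvexOn ℝ (Set.Ioi 0) fun x : ℝ => Real.log x * p := by
    have h := (strictConcaveOn_log_Ioi.concaveOn.smul (neg_nonneg.2 hp)).neg
    refine h.congr fun x _ => ?_
    simp only [Pi.neg_apply, smul_eq_mul]
    ring
  have h : ConvexOn ℝ (Set.Ioi 0) fun x : ℝ => Real.exp (Real.log x * p) :=
    ⟨hlog.1, fun x hx y hy a b ha hb hab =>
      (Real.exp_le_exp.2 (hlog.2 hx hy ha hb hab)).trans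
        (convexOn_exp.2 (Set.mem_univ _) (Set.mem_univ _) ha hb hab)⟩
  refine h.congr fun x hx => ?_
  simp [Real.rpow_def_of_pos (Set.mem_Ioi.1 hx)]

/-- Error of Hermite interpolation at a double node `d` and a simple node `e`: a function with convex
derivative that has a double zero at `d` and a zero at `e > d` is nonpositive to the left of `e`. -/
lemma nonpos_of_double_zero {G g : ℝ → ℝ} {a d e : ℝ} (had : a < d) (hde : d < e)
    (hG : ContinuousOn G (Set.Icc a e)) (hg : ∀ x ∈ Set.Ioo a e, HasDerivAt G (g x) x)
    (hconv : ConvexOn ℝ (Set.Ioo a e) g) (hgd : g d = 0) (hGd : G d = 0) (hGe : G e = 0) {x : ℝ}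
    (hx : x ∈ Set.Icc a e) : G x ≤ 0 := by
  have hsub : ∀ {y z : ℝ}, a ≤ y → z ≤ e → ContinuousOn G (Set.Icc y z) := fun hy hz =>
    hG.mono (Set.Icc_subset_Icc hy hz)
  have hder : ∀ {y z : ℝ}, a ≤ y → z ≤ e → ∀ t ∈ Set.Ioo y z, HasDerivAt G (g t) t :=
    fun hy hz t ht => hg t ⟨hy.trans_lt ht.1, ht.2.trans_le hz⟩
  -- The derivative has a second zero `ξ`; convexity then fixes its sign on the three intervals.
  obtain ⟨ξ, ⟨hξ1, hξ2⟩, hξ⟩ := exists_hasDerivAt_eq_zero hde (hsub had.le le_rfl)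
    (hGd.trans hGe.symm) (hder had.le le_rfl)
  have key : ∀ {t u v : ℝ}, a < t → t < u → u < v → v < e →
      (v - t) * g u ≤ (v - u) * g t + (u - t) * g v := by
    intro t u v hat htu huv hve
    have := hconv.2 (show t ∈ Set.Ioo a e from ⟨hat, by linarith⟩)
      (show v ∈ Set.Ioo a e from ⟨by linarith, hve⟩)
      (show 0 ≤ (v - u) / (v - t) from div_nonneg (by linarith) (by linarith))
      (show 0 ≤ (u - t) / (v - t) from div_nonneg (by linarith) (by linarith))
      (by rw [← add_div]; exact (div_eq_one_iff_eq (by linarith)).2 (by ring))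
    have hvt : v - t ≠ 0 := by linarith
    have hu : (v - u) / (v - t) * t + (u - t) / (v - t) * v = u := by
      field_simp; ring
    simp only [smul_eq_mul, hu] at this
    calc (v - t) * g u ≤ (v - t) * ((v - u) / (v - t) * g t + (u - t) / (v - t) * g v) :=
          mul_le_mul_of_nonneg_left this (by linarith)
      _ = _ := by field_simp
  rcases lt_trichotomy x d with hxd | rfl | hxd
  · obtain ⟨c, ⟨hc1, hc2⟩, hc⟩ := exists_hasDerivAt_eq_slope G g hxd (hsub hx.1 hde.le)
      (hder hx.1 hde.le)
    have h := key (hx.1.trans_lt hc1) hc2 hξ1 hξ2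
    rw [hgd, hξ, hc, hGd] at h
    have h2 : 0 ≤ (0 - G x) / (d - x) :=
      nonneg_of_mul_nonneg_right (by linarith) (sub_pos.2 hξ1)
    rw [le_div_iff₀ (by linarith)] at h2
    linarith
  · exact hGd.le
  · rcases lt_or_ge ξ x with hxξ | hxξ
    · rcases eq_or_lt_of_le hx.2 with rfl | hxe
      · exact hGe.le
      obtain ⟨c, ⟨hc1, hc2⟩, hc⟩ := exists_hasDerivAt_eq_slope G g hxe (hsub hx.1 le_rfl)
        (hder hx.1 le_rfl)
      have h := key had hξ1 (hxξ.trans hc1) hc2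
      rw [hgd, hξ, hc, hGe] at h
      have h2 : 0 ≤ (0 - G x) / (e - x) :=
        nonneg_of_mul_nonneg_right (by linarith) (sub_pos.2 hξ1)
      rw [le_div_iff₀ (by linarith)] at h2
      linarith
    · obtain ⟨c, ⟨hc1, hc2⟩, hc⟩ := exists_hasDerivAt_eq_slope G g hxd (hsub had.le hx.2)
        (hder had.le hx.2)
      have h := key had hc1 (hc2.trans_le hxξ) hξ2
      rw [hgd, hξ, hc, hGd] at h
      have h2 : (G x - 0) / (x - d) ≤ 0 := by
        by_contra hcon
        have := mul_pos (sub_pos.2 hξ1) (not_le.1 hcon)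
        linarith
      rw [div_le_iff₀ (by linarith)] at h2
      linarith

lemma hasDerivAt_rpow_sub_quadratic (m α β γ : ℝ) {x : ℝ} (hx : 0 < x) :
    HasDerivAt (fun t : ℝ => t ^ m - (α + β * t + γ * t ^ 2))
      (m * x ^ (m - 1) - (β + 2 * γ * x)) x := by
  have h := (Real.hasDerivAt_rpow_const (x := x) (p := m) (Or.inl hx.ne')).sub
    ((((hasDerivAt_id x).const_mul β).const_add α).add ((hasDerivAt_pow 2 x).const_mul γ))
  refine h.congr_deriv ?_
  push_cast
  ring

lemma continuousOn_rpow_sub_quadratic (m α β γ : ℝ) {s : Set ℝ}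
    (hs : ∀ x ∈ s, x ≠ 0 ∨ 0 < m) :
    ContinuousOn (fun t : ℝ => t ^ m - (α + β * t + γ * t ^ 2)) s := by
  refine ContinuousOn.sub (fun x hx => ?_) (by fun_prop)
  refine (Real.continuousAt_rpow_const x m ?_).continuousWithinAt
  exact (hs x hx).imp_right le_of_lt

lemma convexOn_affine (β γ : ℝ) {s : Set ℝ} (hs : Convex ℝ s) :
    ConvexOn ℝ s fun x : ℝ => β + γ * x :=
  ⟨hs, fun x _ y _ a b _ _ hab => by
    simp only [smul_eq_mul]
    exact le_of_eq (by linear_combination (-β) * hab)⟩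

/-- If the third derivative of `x ^ m` is nonnegative, then `x ^ m` lies below its quadratic Hermite
interpolant with nodes `1, 1, 4` on `[0, 4]`. -/
lemma exists_quadratic_ge_rpow {m : ℝ} (h0 : 0 < m) (hm : m ≤ 1 ∨ 2 ≤ m) :
    ∃ α β γ : ℝ, α + β + γ = 1 ∧ α + 4 * β + 16 * γ = 4 ^ m ∧
      ∀ x ∈ Set.Icc (0 : ℝ) 4, x ^ m ≤ α + β * x + γ * x ^ 2 := by
  set γ : ℝ := (4 ^ m - 1 - 3 * m) / 9 with hγ
  refine ⟨1 - m + γ, m - 2 * γ, γ, by ring, by rw [hγ]; ring, fun x hx => ?_⟩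
  have hder := convexOn_affine (-(m - 2 * γ)) (-(2 * γ)) (convex_Ioo (0 : ℝ) 4)
  have hpow : ConvexOn ℝ (Set.Ioo (0 : ℝ) 4) fun x : ℝ => x ^ (m - 1) := by
    rcases hm with hm | hm
    · exact (convexOn_rpow_of_nonpos (by linarith)).subset (fun x hx => hx.1) (convex_Ioo _ _)
    · exact (convexOn_rpow (by linarith)).subset (fun x hx => hx.1.le) (convex_Ioo _ _)
  have hconv : ConvexOn ℝ (Set.Ioo (0 : ℝ) 4)
      fun x : ℝ => m * x ^ (m - 1) - ((m - 2 * γ) + 2 * γ * x) :=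
    ((hpow.smul h0.le).add hder).congr fun x _ => by
      simp only [Pi.add_apply, smul_eq_mul]; ring
  have h := nonpos_of_double_zero (a := 0) (d := 1) (e := 4) (by norm_num) (by norm_num)
    (continuousOn_rpow_sub_quadratic m (1 - m + γ) (m - 2 * γ) γ fun _ _ => Or.inr h0)
    (fun x hx => hasDerivAt_rpow_sub_quadratic m (1 - m + γ) (m - 2 * γ) γ hx.1)
    hconv (by simp) (by simp only [Real.one_rpow]; ring) (by rw [hγ]; ring) hx
  linarith

/-- For a negative exponent the third derivative of `x ^ m` is negative, and `x ^ m` lies above its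
quadratic Hermite interpolant with nodes `1, 1, 4` on `(0, 4]`. -/
lemma exists_quadratic_le_rpow {m : ℝ} (h0 : m < 0) :
    ∃ α β γ : ℝ, α + β + γ = 1 ∧ α + 4 * β + 16 * γ = 4 ^ m ∧
      ∀ x ∈ Set.Ioc (0 : ℝ) 4, α + β * x + γ * x ^ 2 ≤ x ^ m := by
  set γ : ℝ := (4 ^ m - 1 - 3 * m) / 9 with hγ
  refine ⟨1 - m + γ, m - 2 * γ, γ, by ring, by rw [hγ]; ring, fun x hx => ?_⟩
  -- The function is unbounded at `0`, so the interpolation error is studied away from `0`.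
  obtain ⟨a, ha0, ha1, hax⟩ : ∃ a : ℝ, 0 < a ∧ a < 1 ∧ a ≤ x :=
    ⟨min x (1 / 2), lt_min hx.1 (by norm_num), (min_le_right _ _).trans_lt (by norm_num),
      min_le_left _ _⟩
  have hder := convexOn_affine (m - 2 * γ) (2 * γ) (convex_Ioo a 4)
  have hpow : ConvexOn ℝ (Set.Ioo a 4) fun x : ℝ => x ^ (m - 1) :=
    (convexOn_rpow_of_nonpos (by linarith)).subset (fun x hx => ha0.trans hx.1) (convex_Ioo _ _)
  have hconv : ConvexOn ℝ (Set.Ioo a 4)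
      fun x : ℝ => -(m * x ^ (m - 1) - ((m - 2 * γ) + 2 * γ * x)) :=
    ((hpow.smul (neg_nonneg.2 h0.le)).add hder).congr fun x _ => by
      simp only [Pi.add_apply, smul_eq_mul]; ring
  have h := nonpos_of_double_zero (a := a) (d := 1) (e := 4) ha1 (by norm_num)
    (continuousOn_rpow_sub_quadratic m (1 - m + γ) (m - 2 * γ) γ
      fun x hx => Or.inl (ha0.trans_le hx.1).ne').neg
    (fun x hx => (hasDerivAt_rpow_sub_quadratic m (1 - m + γ) (m - 2 * γ) γ (ha0.trans hx.1)).neg)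
    hconv (by simp) (by simp only [Pi.neg_apply, Real.one_rpow]; ring)
    (by simp only [Pi.neg_apply]; rw [hγ]; ring) ⟨hax, hx.2⟩
  simp only [Pi.neg_apply] at h
  linarith

/-- For exponents in `[1, 2]` the function `x ^ m` lies below its quadratic Hermite interpolant with
nodes `0, 3, 3` on `[0, 4]`. -/
lemma exists_quadratic_ge_rpow_of_mem_Icc {m : ℝ} (h1 : 1 ≤ m) (h2 : m ≤ 2) :
    ∃ α β γ : ℝ, α = 0 ∧ α + 3 * β + 9 * γ = 3 ^ m ∧
      ∀ x ∈ Set.Icc (0 : ℝ) 4, x ^ m ≤ α + β * x + γ * x ^ 2 := by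
  set γ : ℝ := (m * 3 ^ (m - 1) - 3 ^ m / 3) / 3 with hγ
  set β : ℝ := 3 ^ m / 3 - 3 * γ with hβ
  refine ⟨0, β, γ, rfl, by rw [hβ]; ring, fun x hx => ?_⟩
  have hm : 0 < m := by linarith
  -- The reflection `t = 4 - x` turns the concave derivative into a convex one and moves the double
  -- node to the left of the simple one.
  have haff := convexOn_affine (β + 8 * γ) (-(2 * γ)) (convex_Ioo (0 : ℝ) 4)
  have hpow : ConcaveOn ℝ (Set.Ioo (0 : ℝ) 4) fun t : ℝ => (4 - t) ^ (m - 1) := by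
    refine ⟨convex_Ioo _ _, fun x hx y hy a b ha hb hab => ?_⟩
    have h := (Real.concaveOn_rpow (p := m - 1) (by linarith) (by linarith)).2
      (show 4 - x ∈ Set.Ici (0 : ℝ) from sub_nonneg.2 hx.2.le)
      (show 4 - y ∈ Set.Ici (0 : ℝ) from sub_nonneg.2 hy.2.le) ha hb hab
    have he : a • (4 - x) + b • (4 - y) = 4 - (a • x + b • y) := by
      simp only [smul_eq_mul]; linear_combination 4 * hab
    rwa [he] at h
  have hconv : ConvexOn ℝ (Set.Ioo (0 : ℝ) 4)
      fun t : ℝ => -(m * (4 - t) ^ (m - 1) - (β + 2 * γ * (4 - t))) :=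
    ((hpow.smul hm.le).neg.add haff).congr fun x _ => by
      simp only [Pi.add_apply, Pi.neg_apply, smul_eq_mul]; ring
  have hG := continuousOn_rpow_sub_quadratic m 0 β γ (s := Set.univ) fun _ _ => Or.inr hm
  have h := nonpos_of_double_zero
    (G := fun t : ℝ => (4 - t) ^ m - (0 + β * (4 - t) + γ * (4 - t) ^ 2))
    (a := 0) (d := 1) (e := 4) (by norm_num) (by norm_num)
    (hG.comp (g := fun t : ℝ => t ^ m - (0 + β * t + γ * t ^ 2)) (f := fun t : ℝ => 4 - t)
      (by fun_prop) (fun _ _ => Set.mem_univ _))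
    (fun t ht => by
      have h4 : HasDerivAt (fun t : ℝ => 4 - t) (-1) t := by
        simpa using (hasDerivAt_id t).const_sub 4
      have := (hasDerivAt_rpow_sub_quadratic m 0 β γ (x := 4 - t) (by linarith [ht.2])).comp t h4
      exact this.congr_deriv (by ring))
    hconv (by norm_num; rw [hβ, hγ]; ring) (by norm_num; rw [hβ]; ring)
    (by simp [hm.ne']) (x := 4 - x) ⟨by linarith [hx.2], by linarith [hx.1]⟩
  simp only [sub_sub_cancel] at h
  linarith

/-! ### Chords of the unit circle -/

/-- The inner product of two points of the unit circle, regarded as plane vectors. -/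
def circleInner (z w : Circle) : ℝ := (z : ℂ).re * (w : ℂ).re + (z : ℂ).im * (w : ℂ).im

lemma Circle.re_sq_add_im_sq (z : Circle) : (z : ℂ).re ^ 2 + (z : ℂ).im ^ 2 = 1 := by
  have h := Circle.normSq_coe z
  rw [Complex.normSq_apply] at h
  linarith

lemma circleInner_self (z : Circle) : circleInner z z = 1 := by
  have := z.re_sq_add_im_sq
  simp only [circleInner]; linarith

lemma circleInner_comm (z w : Circle) : circleInner z w = circleInner w z := by
  simp only [circleInner]; ring

lemma circleInner_neg_left (z w : Circle) : circleInner (-z) w = -circleInner z w := by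
  simp [circleInner]; ring

lemma circleInner_neg_right (z w : Circle) : circleInner z (-w) = -circleInner z w := by
  simp [circleInner]; ring

lemma circleInner_le_one (z w : Circle) : circleInner z w ≤ 1 := by
  have hz := z.re_sq_add_im_sq
  have hw := w.re_sq_add_im_sq
  simp only [circleInner]
  nlinarith [sq_nonneg ((z : ℂ).re - (w : ℂ).re), sq_nonneg ((z : ℂ).im - (w : ℂ).im)]

lemma neg_one_le_circleInner (z w : Circle) : -1 ≤ circleInner z w := by
  have := circleInner_le_one (-z) w
  rw [circleInner_neg_left] at this
  linarith

/-- The Gram determinant of three vectors of the plane vanishes. -/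
lemma gram_det_eq_zero (u v w : Circle) :
    1 + 2 * circleInner u v * circleInner v w * circleInner w u - circleInner u v ^ 2 -
      circleInner v w ^ 2 - circleInner w u ^ 2 = 0 := by
  have hu := u.re_sq_add_im_sq
  have hv := v.re_sq_add_im_sq
  have hw := w.re_sq_add_im_sq
  simp only [circleInner]
  generalize (u : ℂ).re = a at *
  generalize (u : ℂ).im = b at *
  generalize (v : ℂ).re = c at *
  generalize (v : ℂ).im = d at *
  generalize (w : ℂ).re = e at *
  generalize (w : ℂ).im = f at *
  have h : (a ^ 2 + b ^ 2) * (c ^ 2 + d ^ 2) * (e ^ 2 + f ^ 2) +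
      2 * (a * c + b * d) * (c * e + d * f) * (e * a + f * b) -
      (a * c + b * d) ^ 2 * (e ^ 2 + f ^ 2) - (c * e + d * f) ^ 2 * (a ^ 2 + b ^ 2) -
      (e * a + f * b) ^ 2 * (c ^ 2 + d ^ 2) = 0 := by ring
  rw [hu, hv, hw] at h
  linarith

/-- The squared distance between two points of the unit circle, in terms of their inner product; see
`dist_sq_eq_chordSq`. -/
def chordSq (z w : Circle) : ℝ := 2 - 2 * circleInner z w

lemma chordSq_nonneg (z w : Circle) : 0 ≤ chordSq z w := by
  have := circleInner_le_one z w
  simp only [chordSq]; linarith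

lemma dist_sq_eq_chordSq (z w : Circle) : dist (z : ℂ) (w : ℂ) ^ 2 = chordSq z w := by
  have hz := z.re_sq_add_im_sq
  have hw := w.re_sq_add_im_sq
  rw [Complex.dist_eq, ← Complex.normSq_eq_norm_sq, Complex.normSq_apply]
  simp only [chordSq, circleInner, Complex.sub_re, Complex.sub_im]
  linarith

lemma dist_rpow_eq_chordSq_rpow (z w : Circle) (s : ℝ) :
    dist (z : ℂ) (w : ℂ) ^ s = chordSq z w ^ (s / 2) := by
  rw [← dist_sq_eq_chordSq, ← Real.rpow_natCast_mul dist_nonneg]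
  congr 1
  push_cast
  ring

lemma ne_of_chordSq_pos {z w : Circle} (h : 0 < chordSq z w) : z ≠ w := by
  rintro rfl
  simp [chordSq, circleInner_self] at h

lemma chordSq_pos_of_ne {z w : Circle} (h : z ≠ w) : 0 < chordSq z w := by
  rw [← dist_sq_eq_chordSq]
  exact pow_pos (dist_pos.2 fun h' => h (Circle.ext h')) 2

lemma powerSum_eq_chordSq (A B C M : Circle) (s : ℝ) :
    powerSum A B C M s =
      chordSq M A ^ (s / 2) + chordSq M B ^ (s / 2) + chordSq M C ^ (s / 2) := by
  simp only [powerSum, dist_rpow_eq_chordSq_rpow]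

lemma two_rpow_eq (s : ℝ) : (2 : ℝ) ^ s = 4 ^ (s / 2) := by
  have : (4 : ℝ) = 2 ^ 2 := by norm_num
  rw [this, ← Real.rpow_natCast_mul (by norm_num)]
  congr 1
  push_cast
  ring

lemma sqrt_three_rpow_eq (s : ℝ) : Real.sqrt 3 ^ s = 3 ^ (s / 2) := by
  rw [Real.sqrt_eq_rpow, ← Real.rpow_mul (by norm_num)]
  congr 1
  ring

/-! ### Equilateral triples -/

/-- The squared length of `A + B + C` is `3 + 2 * (⟪A, B⟫ + ⟪B, C⟫ + ⟪C, A⟫)`. -/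
lemma sum_eq_zero_iff_circleInner (A B C : Circle) :
    (A : ℂ) + B + C = 0 ↔ circleInner A B + circleInner B C + circleInner C A = -3 / 2 := by
  have hA := A.re_sq_add_im_sq
  have hB := B.re_sq_add_im_sq
  have hC := C.re_sq_add_im_sq
  have h : Complex.normSq ((A : ℂ) + B + C) =
      3 + 2 * (circleInner A B + circleInner B C + circleInner C A) := by
    simp only [circleInner, Complex.normSq_apply, Complex.add_re, Complex.add_im]
    linarith
  rw [← Complex.normSq_eq_zero, h]
  constructor <;> intro h <;> linarith

lemma neg_three_halves_lt_of_sum_ne_zero {A B C : Circle} (h : (A : ℂ) + B + C ≠ 0) :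
    -3 / 2 < circleInner A B + circleInner B C + circleInner C A := by
  have hA := A.re_sq_add_im_sq
  have hB := B.re_sq_add_im_sq
  have hC := C.re_sq_add_im_sq
  have h := Complex.normSq_pos.2 h
  simp only [circleInner, Complex.normSq_apply, Complex.add_re, Complex.add_im] at *
  linarith

/-- Two of three unit vectors with sum zero enclose an angle of `120°`. -/
lemma circleInner_eq_neg_half {A B C : Circle} (h : (A : ℂ) + B + C = 0) :
    circleInner A B = -1 / 2 := by
  have hA := A.re_sq_add_im_sq
  have hB := B.re_sq_add_im_sq
  have hC := C.re_sq_add_im_sq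
  have hre := congrArg Complex.re h
  have him := congrArg Complex.im h
  simp only [Complex.add_re, Complex.add_im, Complex.zero_re, Complex.zero_im] at hre him
  rw [show (C : ℂ).re = -((A : ℂ).re + (B : ℂ).re) by linarith,
    show (C : ℂ).im = -((A : ℂ).im + (B : ℂ).im) by linarith] at hC
  simp only [circleInner]
  linarith

lemma sum_rotate {A B C : Circle} (h : (A : ℂ) + B + C = 0) : (B : ℂ) + C + A = 0 := by
  rw [← h]; ring

lemma isEquilateralTriple_iff_sum_eq_zero (A B C : Circle) :
    IsEquilateralTriple A B C ↔ (A : ℂ) + B + C = 0 := by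
  have hsq : ∀ z w : Circle, circleInner z w = 1 - dist (z : ℂ) w ^ 2 / 2 := fun z w => by
    rw [dist_sq_eq_chordSq, chordSq]; ring
  constructor
  · rintro ⟨T, hT, r, hr⟩
    have hAB := hr 0 1 (by decide)
    have hBC := hr 1 2 (by decide)
    have hCA := hr 2 0 (by decide)
    have hne : T.points 0 ≠ T.points 1 := T.independent.injective.ne (by decide)
    simp only [hT, Matrix.cons_val_zero, Matrix.cons_val_one, Matrix.cons_val] at hAB hBC hCA hne
    have hrpos : 0 < r := hAB ▸ dist_pos.2 hne
    have hg := gram_det_eq_zero A B C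
    rw [sum_eq_zero_iff_circleInner]
    rw [hsq A B, hsq B C, hsq C A, hAB, hBC, hCA] at *
    -- With equal inner products `p` the Gram determinant is `(1 - p) ^ 2 * (1 + 2 * p)`.
    have h0 : (r ^ 2 / 2) ^ 2 * (3 - r ^ 2) = 0 := by linear_combination hg
    have : 3 - r ^ 2 = 0 := (mul_eq_zero.1 h0).resolve_left (by positivity)
    linarith
  · intro h
    have hAB := circleInner_eq_neg_half h
    have hBC := circleInner_eq_neg_half (sum_rotate h)
    have hCA := circleInner_eq_neg_half (sum_rotate (sum_rotate h))
    have hdist : ∀ z w : Circle, circleInner z w = -1 / 2 → dist (z : ℂ) w = Real.sqrt 3 :=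
      fun z w hzw => by
        rw [eq_comm, Real.sqrt_eq_iff_mul_self_eq (by norm_num) dist_nonneg]
        rw [hsq] at hzw
        linarith
    have hne : ∀ z w : Circle, circleInner z w = -1 / 2 → (z : ℂ) ≠ w := fun z w hzw =>
      dist_pos.1 (by rw [hdist z w hzw]; positivity)
    have hcos : EuclideanGeometry.Cospherical ({(A : ℂ), (B : ℂ), (C : ℂ)} : Set ℂ) := by
      refine ⟨0, 1, ?_⟩
      simp [Circle.norm_coe]
    refine ⟨⟨_, hcos.affineIndependent_of_ne (hne A B hAB)
      (hne C A hCA).symm (hne B C hBC)⟩, rfl, Real.sqrt 3, ?_⟩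
    intro i j hij
    have h01 := hdist A B hAB
    have h12 := hdist B C hBC
    have h20 := hdist C A hCA
    fin_cases i <;> fin_cases j <;> first
      | exact absurd rfl hij
      | assumption
      | (rw [dist_comm]; assumption)

/-- An equilateral triple exists: the cube roots of unity. -/
lemma exists_sum_eq_zero : ∃ A B C : Circle, (A : ℂ) + B + C = 0 := by
  have h3 : Real.sqrt 3 ^ 2 = 3 := Real.sq_sqrt (by norm_num)
  have hmem : ∀ y : ℝ, y ^ 2 = 3 → (⟨-1 / 2, y / 2⟩ : ℂ) ∈ Submonoid.unitSphere ℂ := fun y hy => by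
    change _ ∈ Metric.sphere (0 : ℂ) 1
    rw [mem_sphere_zero_iff_norm, ← sq_eq_sq₀ (norm_nonneg _) (by norm_num),
      ← Complex.normSq_eq_norm_sq, Complex.normSq_mk]
    linarith
  refine ⟨1, ⟨_, hmem (Real.sqrt 3) h3⟩, ⟨_, hmem (-Real.sqrt 3) (by rw [neg_sq, h3])⟩, ?_⟩
  apply Complex.ext
  · simp; norm_num
  · simp; ring

/-- For an equilateral triple the sums of the second and of the fourth powers of the three distances
do not depend on the point of the circle. -/
lemma chordSq_moments {A B C : Circle} (h : (A : ℂ) + B + C = 0) (M : Circle) :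
    chordSq M A + chordSq M B + chordSq M C = 6 ∧
      chordSq M A ^ 2 + chordSq M B ^ 2 + chordSq M C ^ 2 = 18 := by
  have hre := congrArg Complex.re h
  have him := congrArg Complex.im h
  simp only [Complex.add_re, Complex.add_im, Complex.zero_re, Complex.zero_im] at hre him
  have hsum : circleInner M A + circleInner M B + circleInner M C = 0 := by
    simp only [circleInner]
    linear_combination (M : ℂ).re * hre + (M : ℂ).im * him
  have hg := gram_det_eq_zero M A B
  rw [circleInner_eq_neg_half h, circleInner_comm B M] at hg
  have hC : circleInner M C = -(circleInner M A + circleInner M B) := by linarith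
  simp only [chordSq, hC]
  constructor
  · ring
  · linear_combination (-8) * hg

lemma chordSq_le_four (z w : Circle) : chordSq z w ≤ 4 := by
  have := neg_one_le_circleInner z w
  simp only [chordSq]; linarith

lemma powerSum_self_of_sum_eq_zero {A B C : Circle} (h : (A : ℂ) + B + C = 0) {s : ℝ}
    (hs : 0 < s) : powerSum A B C A s = 2 * Real.sqrt 3 ^ s := by
  rw [powerSum_eq_chordSq, sqrt_three_rpow_eq]
  simp only [chordSq, circleInner_self, circleInner_eq_neg_half h, circleInner_comm A C,
    circleInner_eq_neg_half (sum_rotate (sum_rotate h))]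
  norm_num
  rw [Real.zero_rpow (by positivity)]
  ring

lemma chordSq_antipode_of_sum_eq_zero {A B C : Circle} (h : (A : ℂ) + B + C = 0) :
    chordSq (-A) A = 4 ∧ chordSq (-A) B = 1 ∧ chordSq (-A) C = 1 := by
  simp only [chordSq, circleInner_neg_left, circleInner_self, circleInner_eq_neg_half h,
    circleInner_comm A C, circleInner_eq_neg_half (sum_rotate (sum_rotate h))]
  norm_num

lemma powerSum_antipode_of_sum_eq_zero {A B C : Circle} (h : (A : ℂ) + B + C = 0) (s : ℝ) :
    powerSum A B C (-A) s = 2 + 2 ^ s := by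
  obtain ⟨hA, hB, hC⟩ := chordSq_antipode_of_sum_eq_zero h
  rw [powerSum_eq_chordSq, two_rpow_eq, hA, hB, hC, Real.one_rpow]
  ring

lemma isGreatest_of_sum_eq_zero {A B C : Circle} (h : (A : ℂ) + B + C = 0) {s : ℝ} (h0 : 0 < s)
    (hs : s ≤ 2 ∨ 4 ≤ s) : IsGreatest (valuesOnCircle A B C s) (2 + 2 ^ s) := by
  refine ⟨⟨-A, powerSum_antipode_of_sum_eq_zero h s⟩, ?_⟩
  rintro _ ⟨M, rfl⟩
  obtain ⟨α, β, γ, h1, h4, hq⟩ := exists_quadratic_ge_rpow (m := s / 2) (by linarith)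
    (hs.imp (fun h => by linarith) fun h => by linarith)
  obtain ⟨hm1, hm2⟩ := chordSq_moments h M
  have hq' := fun z => hq (chordSq M z) ⟨chordSq_nonneg M z, chordSq_le_four M z⟩
  rw [powerSum_eq_chordSq, two_rpow_eq, ← h4]
  calc _ ≤ _ := add_le_add (add_le_add (hq' A) (hq' B)) (hq' C)
    _ = _ := by linear_combination β * hm1 + γ * hm2 + 2 * h1

lemma isGreatest_sqrt_three_of_sum_eq_zero {A B C : Circle} (h : (A : ℂ) + B + C = 0) {s : ℝ}
    (h2 : 2 ≤ s) (h4 : s ≤ 4) : IsGreatest (valuesOnCircle A B C s) (2 * Real.sqrt 3 ^ s) := by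
  refine ⟨⟨A, powerSum_self_of_sum_eq_zero h (by linarith)⟩, ?_⟩
  rintro _ ⟨M, rfl⟩
  obtain ⟨α, β, γ, hα, hβ, hq⟩ := exists_quadratic_ge_rpow_of_mem_Icc (m := s / 2) (by linarith)
    (by linarith)
  obtain ⟨hm1, hm2⟩ := chordSq_moments h M
  have hq' := fun z => hq (chordSq M z) ⟨chordSq_nonneg M z, chordSq_le_four M z⟩
  rw [powerSum_eq_chordSq, sqrt_three_rpow_eq, ← hβ]
  calc _ ≤ _ := add_le_add (add_le_add (hq' A) (hq' B)) (hq' C)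
    _ = _ := by linear_combination β * hm1 + γ * hm2 + hα

lemma isLeast_of_sum_eq_zero {A B C : Circle} (h : (A : ℂ) + B + C = 0) {s : ℝ} (h0 : s < 0) :
    IsLeast (valuesOffPoints A B C s) (2 + 2 ^ s) := by
  constructor
  · obtain ⟨hA, hB, hC⟩ := chordSq_antipode_of_sum_eq_zero h
    refine ⟨-A, ne_of_chordSq_pos ?_, ne_of_chordSq_pos ?_, ne_of_chordSq_pos ?_,
      powerSum_antipode_of_sum_eq_zero h s⟩ <;> norm_num [hA, hB, hC]
  rintro _ ⟨M, hA, hB, hC, rfl⟩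
  obtain ⟨α, β, γ, h1, h4, hq⟩ := exists_quadratic_le_rpow (m := s / 2) (by linarith)
  obtain ⟨hm1, hm2⟩ := chordSq_moments h M
  have hq' := fun {z : Circle} (hz : M ≠ z) =>
    hq (chordSq M z) ⟨chordSq_pos_of_ne hz, chordSq_le_four M z⟩
  rw [powerSum_eq_chordSq, two_rpow_eq, ← h4]
  calc _ = _ := by linear_combination -(β * hm1) - γ * hm2 - 2 * h1
    _ ≤ _ := add_le_add (add_le_add (hq' hA) (hq' hB)) (hq' hC)

/-! ### The midpoint of the largest arc -/

lemma circleInner_mul_left (z u w : Circle) : circleInner (z * u) (z * w) = circleInner u w := by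
  have hz := z.re_sq_add_im_sq
  simp only [circleInner, Circle.coe_mul, Complex.mul_re, Complex.mul_im]
  linear_combination ((u : ℂ).re * (w : ℂ).re + (u : ℂ).im * (w : ℂ).im) * hz

/-- In terms of arguments, `cos (α + β - 2γ) = 2 cos (α - γ) cos (β - γ) - cos (α - β)`. -/
lemma circleInner_mul_mul_self (a b c : Circle) :
    circleInner (a * b) (c * c) = 2 * circleInner a c * circleInner b c - circleInner a b := by
  have hc := c.re_sq_add_im_sq
  simp only [circleInner, Circle.coe_mul, Complex.mul_re, Complex.mul_im]
  linear_combination (-((a : ℂ).re * (b : ℂ).re + (a : ℂ).im * (b : ℂ).im)) * hc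

lemma exists_mul_self_eq (A : Circle) : ∃ a : Circle, a * a = A :=
  ⟨Circle.exp (Complex.arg A / 2), by rw [← Circle.exp_add, add_halves, Circle.exp_arg]⟩

/-- The numbers `x`, `y`, `z` play the role of the cosines of the angles of a triangle, `z` belonging
to the largest angle. -/
lemma cos_relations {x y z : ℝ} (hzx : |z| ≤ x) (hzy : |z| ≤ y)
    (h : x ^ 2 + y ^ 2 + z ^ 2 + 2 * x * y * z = 1) :
    z ≤ 1 / 2 ∧ |z| ≤ 2 * x * y ∧ (z = 1 / 2 → x = 1 / 2 ∧ y = 1 / 2) := by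
  have hx : 0 ≤ x := (abs_nonneg z).trans hzx
  have hy : 0 ≤ y := (abs_nonneg z).trans hzy
  have hzle := le_abs_self z
  refine ⟨?_, ?_, ?_⟩
  · by_contra! hz
    have hx2 : 1 / 2 < x := by linarith
    have hy2 : 1 / 2 < y := by linarith
    have hxy : 1 / 4 < x * y := by nlinarith
    have hxyz : 1 / 8 < x * y * z := by nlinarith
    nlinarith
  · by_contra! hz
    have hz0 : 0 < |z| := lt_of_le_of_lt (by positivity) hz
    have hy2 : y < 1 / 2 := by
      by_contra! hy2
      nlinarith
    have hx2 : x < 1 / 2 := by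
      by_contra! hx2
      nlinarith
    have hxy : x * y < 1 / 4 := by nlinarith
    have hxyz : x * y * z ≤ x * y * |z| := mul_le_mul_of_nonneg_left hzle (by positivity)
    have hzz := sq_abs z
    have : x * y * |z| ≤ 1 / 4 * |z| := mul_le_mul_of_nonneg_right hxy.le hz0.le
    nlinarith
  · rintro rfl
    rw [abs_of_pos (by norm_num)] at hzx hzy
    constructor <;> nlinarith [mul_nonneg hx hy]

/-- The point `M` is equidistant from two of the three points; `v` and `b` are its squared distances
from these two and from the third one. The inequalities say that the distances are large enough for
the concavity argument of `two_add_four_rpow_lt`. -/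
def HasFarMidpoint (A B C : Circle) : Prop :=
  ∃ (M : Circle) (v b : ℝ), 1 ≤ v ∧ 2 ≤ b ∧ 6 ≤ 2 * v + b ∧ (v = 1 → (A : ℂ) + B + C = 0) ∧
    (M ≠ A ∧ M ≠ B ∧ M ≠ C) ∧ ∀ s : ℝ, powerSum A B C M s = 2 * v ^ (s / 2) + b ^ (s / 2)

lemma HasFarMidpoint.rotate {A B C : Circle} (h : HasFarMidpoint A B C) : HasFarMidpoint B C A := by
  obtain ⟨M, v, b, h1, h2, h3, h4, ⟨hA, hB, hC⟩, h6⟩ := h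
  refine ⟨M, v, b, h1, h2, h3, fun h => sum_rotate (h4 h), ⟨hB, hC, hA⟩, fun s => ?_⟩
  rw [← h6 s, powerSum, powerSum]
  ring

/-- For square roots `a`, `b`, `c` of the three points with nonnegative inner products
`⟪b, c⟫, ⟪c, a⟫ ≥ |⟪a, b⟫|`, the midpoint of the largest arc is `-a * b`. -/
lemma hasFarMidpoint_of_nonneg {a b c : Circle} (hbc : |circleInner a b| ≤ circleInner b c)
    (hca : |circleInner a b| ≤ circleInner c a) : HasFarMidpoint (a * a) (b * b) (c * c) := by
  have hg := gram_det_eq_zero a b c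
  have hA : chordSq (-(a * b)) (a * a) = 2 + 2 * circleInner a b := by
    rw [chordSq, circleInner_neg_left, circleInner_mul_left, circleInner_comm b a]; ring
  have hB : chordSq (-(a * b)) (b * b) = 2 + 2 * circleInner a b := by
    rw [chordSq, circleInner_neg_left, mul_comm a b, circleInner_mul_left]; ring
  have hC : chordSq (-(a * b)) (c * c) =
      2 + 2 * (2 * circleInner b c * circleInner c a - circleInner a b) := by
    rw [chordSq, circleInner_neg_left, circleInner_mul_mul_self, circleInner_comm a c]; ring
  have hAB : circleInner (a * a) (b * b) = 2 * circleInner a b ^ 2 - 1 := by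
    rw [circleInner_mul_mul_self, circleInner_self]; ring
  have hBC : circleInner (b * b) (c * c) = 2 * circleInner b c ^ 2 - 1 := by
    rw [circleInner_mul_mul_self, circleInner_self]; ring
  have hCA : circleInner (c * c) (a * a) = 2 * circleInner c a ^ 2 - 1 := by
    rw [circleInner_mul_mul_self, circleInner_self]; ring
  obtain ⟨h1, h2, h3⟩ := cos_relations (x := circleInner b c) (y := circleInner c a)
    (z := -circleInner a b) (by rwa [abs_neg]) (by rwa [abs_neg]) (by linarith)
  obtain ⟨h2', h2''⟩ := abs_le.1 h2
  refine ⟨-(a * b), 2 + 2 * circleInner a b,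
    2 + 2 * (2 * circleInner b c * circleInner c a - circleInner a b), ?_, ?_, ?_, ?_,
    ⟨ne_of_chordSq_pos ?_, ne_of_chordSq_pos ?_, ne_of_chordSq_pos ?_⟩,
    fun s => (powerSum_eq_chordSq _ _ _ _ s).trans ?_⟩
  · linarith
  · linarith
  · linarith
  · intro hv
    obtain ⟨hx, hy⟩ := h3 (by linarith)
    rw [sum_eq_zero_iff_circleInner, hAB, hBC, hCA, hx, hy,
      show circleInner a b = -1 / 2 by linarith]
    norm_num
  · rw [hA]; linarith
  · rw [hB]; linarith
  · rw [hC]; linarith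
  · rw [hA, hB, hC]; ring

lemma hasFarMidpoint_of_abs_le {a b c : Circle} (hbc : |circleInner a b| ≤ |circleInner b c|)
    (hca : |circleInner a b| ≤ |circleInner c a|) : HasFarMidpoint (a * a) (b * b) (c * c) := by
  -- Changing the signs of the square roots `a` and `b` makes both inner products with `c` nonnegative.
  have hsign : ∀ z : Circle, ∃ w : Circle, w * w = z * z ∧ circleInner w c = |circleInner z c| ∧
      (w = z ∨ w = -z) := fun z => by
    rcases abs_choice (circleInner z c) with h | h
    · exact ⟨z, rfl, h.symm, Or.inl rfl⟩
    · exact ⟨-z, neg_mul_neg z z, by rw [circleInner_neg_left, h], Or.inr rfl⟩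
  obtain ⟨a', ha, hac, ha'⟩ := hsign a
  obtain ⟨b', hb, hbc', hb'⟩ := hsign b
  have hab : |circleInner a' b'| = |circleInner a b| := by
    rcases ha' with rfl | rfl <;> rcases hb' with rfl | rfl <;>
      simp [circleInner_neg_left, circleInner_neg_right]
  rw [← ha, ← hb]
  refine hasFarMidpoint_of_nonneg ?_ ?_
  · rwa [hab, hbc']
  · rwa [hab, circleInner_comm c a', hac, circleInner_comm a c]

lemma hasFarMidpoint (A B C : Circle) : HasFarMidpoint A B C := by
  obtain ⟨a, rfl⟩ := exists_mul_self_eq A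
  obtain ⟨b, rfl⟩ := exists_mul_self_eq B
  obtain ⟨c, rfl⟩ := exists_mul_self_eq C
  rcases le_total |circleInner a b| |circleInner b c| with h1 | h1
  · rcases le_total |circleInner a b| |circleInner c a| with h2 | h2
    · exact hasFarMidpoint_of_abs_le h1 h2
    · exact (hasFarMidpoint_of_abs_le h2 (h2.trans h1)).rotate
  · rcases le_total |circleInner b c| |circleInner c a| with h2 | h2
    · exact (hasFarMidpoint_of_abs_le h2 h1).rotate.rotate
    · exact (hasFarMidpoint_of_abs_le (h2.trans h1) h2).rotate

/-- With `f x = x ^ m`: if `v ≤ 2`, concavity gives `f v ≥ (2 - v) f 1 + (v - 1) f 2` and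
`f (6 - 2 v) ≥ (2 - v) f 4 + (v - 1) f 2`, which interpolates between `2 f 1 + f 4` and the larger
value `3 f 2`. -/
lemma two_add_four_rpow_lt {m v b : ℝ} (h0 : 0 < m) (h1 : m < 1) (hv : 1 < v) (hb : 2 ≤ b)
    (hvb : 6 ≤ 2 * v + b) : 2 + (4 : ℝ) ^ m < 2 * v ^ m + b ^ m := by
  have h2 : 1 < (2 : ℝ) ^ m := Real.one_lt_rpow (by norm_num) h0
  have h2' : (2 : ℝ) ^ m < 2 := by
    simpa using Real.rpow_lt_rpow_of_exponent_lt (x := 2) (by norm_num) h1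
  have h4 : (4 : ℝ) ^ m = 2 ^ m * 2 ^ m := by
    rw [← Real.mul_rpow (by norm_num) (by norm_num)]; norm_num
  have h3 : 2 + (4 : ℝ) ^ m < 3 * 2 ^ m := by nlinarith
  rcases le_total 2 v with hv2 | hv2
  · have e1 := Real.rpow_le_rpow (by norm_num) hv2 h0.le
    have e2 := Real.rpow_le_rpow (by norm_num) hb h0.le
    linarith
  · have hc := (Real.concaveOn_rpow h0.le h1.le).2
    have e1 := hc (show (1 : ℝ) ∈ Set.Ici 0 by simp) (show (2 : ℝ) ∈ Set.Ici 0 by simp)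
      (sub_nonneg.2 hv2) (sub_nonneg.2 hv.le) (by ring)
    have e2 := hc (show (4 : ℝ) ∈ Set.Ici 0 by simp) (show (2 : ℝ) ∈ Set.Ici 0 by simp)
      (sub_nonneg.2 hv2) (sub_nonneg.2 hv.le) (by ring)
    have e3 : (6 - 2 * v) ^ m ≤ b ^ m := Real.rpow_le_rpow (by linarith) (by linarith) h0.le
    simp only [smul_eq_mul, Real.one_rpow] at e1 e2
    rw [show (2 - v) * 1 + (v - 1) * 2 = v by ring] at e1
    rw [show (2 - v) * 4 + (v - 1) * 2 = 6 - 2 * v by ring] at e2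
    nlinarith [mul_pos (sub_pos.2 hv) (sub_pos.2 h3)]

/-- The counterpart of `two_add_four_rpow_lt` for negative exponents, where `x ^ m` is convex and
decreasing. -/
lemma two_add_four_rpow_gt {m v b : ℝ} (h0 : m < 0) (hv : 1 < v) (hb : 2 ≤ b)
    (hvb : 6 ≤ 2 * v + b) : 2 * v ^ m + b ^ m < 2 + (4 : ℝ) ^ m := by
  have h2 : 0 < (2 : ℝ) ^ m := by positivity
  have h2' : (2 : ℝ) ^ m < 1 := Real.rpow_lt_one_of_one_lt_of_neg (by norm_num) h0
  have h4 : (4 : ℝ) ^ m = 2 ^ m * 2 ^ m := by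
    rw [← Real.mul_rpow (by norm_num) (by norm_num)]; norm_num
  have h3 : 3 * 2 ^ m < 2 + (4 : ℝ) ^ m := by nlinarith
  rcases le_total 2 v with hv2 | hv2
  · have e1 := Real.rpow_le_rpow_of_nonpos (by norm_num) hv2 h0.le
    have e2 := Real.rpow_le_rpow_of_nonpos (by norm_num) hb h0.le
    linarith
  · have hc := (convexOn_rpow_of_nonpos h0.le).2
    have e1 := hc (show (1 : ℝ) ∈ Set.Ioi 0 by simp) (show (2 : ℝ) ∈ Set.Ioi 0 by simp)
      (sub_nonneg.2 hv2) (sub_nonneg.2 hv.le) (by ring)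
    have e2 := hc (show (4 : ℝ) ∈ Set.Ioi 0 by simp) (show (2 : ℝ) ∈ Set.Ioi 0 by simp)
      (sub_nonneg.2 hv2) (sub_nonneg.2 hv.le) (by ring)
    have e3 : b ^ m ≤ (6 - 2 * v) ^ m :=
      Real.rpow_le_rpow_of_nonpos (by linarith) (by linarith) h0.le
    simp only [smul_eq_mul, Real.one_rpow] at e1 e2
    rw [show (2 - v) * 1 + (v - 1) * 2 = v by ring] at e1
    rw [show (2 - v) * 4 + (v - 1) * 2 = 6 - 2 * v by ring] at e2
    nlinarith [mul_pos (sub_pos.2 hv) (sub_pos.2 h3)]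

lemma exists_powerSum_lt_of_neg {A B C : Circle} (h : (A : ℂ) + B + C ≠ 0) {s : ℝ} (hs : s < 0) :
    ∃ M : Circle, M ≠ A ∧ M ≠ B ∧ M ≠ C ∧ powerSum A B C M s < 2 + 2 ^ s := by
  obtain ⟨M, v, b, hv, hb, hvb, hv1, ⟨hA, hB, hC⟩, hM⟩ := hasFarMidpoint A B C
  refine ⟨M, hA, hB, hC, ?_⟩
  rw [hM, two_rpow_eq]
  exact two_add_four_rpow_gt (by linarith) (lt_of_le_of_ne hv fun h' => h (hv1 h'.symm)) hb hvb

lemma exists_lt_powerSum_of_lt_two {A B C : Circle} (h : (A : ℂ) + B + C ≠ 0) {s : ℝ} (hs : 0 < s)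
    (h2 : s < 2) : ∃ M : Circle, 2 + 2 ^ s < powerSum A B C M s := by
  obtain ⟨M, v, b, hv, hb, hvb, hv1, -, hM⟩ := hasFarMidpoint A B C
  refine ⟨M, ?_⟩
  rw [hM, two_rpow_eq]
  exact two_add_four_rpow_lt (by linarith) (by linarith)
    (lt_of_le_of_ne hv fun h' => h (hv1 h'.symm)) hb hvb

/-! ### Antipodes and vertices -/

/-- Bernoulli's inequality, as the tangent line of `t ^ m` at `1`. -/
lemma one_add_mul_sub_one_le_rpow {t m : ℝ} (ht : 0 ≤ t) (hm : 1 ≤ m) :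
    1 + m * (t - 1) ≤ t ^ m := by
  simpa using one_add_mul_self_le_rpow_one_add (s := t - 1) (by linarith) hm

lemma one_add_mul_sub_one_lt_rpow {t m : ℝ} (ht : 0 ≤ t) (ht1 : t ≠ 1) (hm : 1 < m) :
    1 + m * (t - 1) < t ^ m := by
  simpa using one_add_mul_self_lt_rpow_one_add (s := t - 1) (by linarith) (sub_ne_zero.2 ht1) hm

lemma rpow_eq_three_rpow_mul {x : ℝ} (hx : 0 ≤ x) (m : ℝ) : x ^ m = 3 ^ m * (x / 3) ^ m := by
  rw [← Real.mul_rpow (by norm_num) (by positivity)]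
  congr 1
  ring

lemma chordSq_neg_self (A : Circle) : chordSq (-A) A = 4 := by
  rw [chordSq, circleInner_neg_left, circleInner_self]; norm_num

lemma chordSq_neg_left (A B : Circle) : chordSq (-A) B = 2 + 2 * circleInner A B := by
  rw [chordSq, circleInner_neg_left]; ring

lemma powerSum_rotate (A B C M : Circle) (s : ℝ) : powerSum B C A M s = powerSum A B C M s := by
  simp only [powerSum]; ring

/-- The inner products of a non-equilateral triple have sum greater than `-3/2`, so by Bernoulli's
inequality one of the three antipodes of the points is far enough from the two other points. -/
lemma exists_lt_powerSum_of_two_le {A B C : Circle} (h : (A : ℂ) + B + C ≠ 0) {s : ℝ} (hs : 2 ≤ s) :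
    ∃ M : Circle, 2 + 2 ^ s < powerSum A B C M s := by
  have hsum := neg_three_halves_lt_of_sum_ne_zero h
  have hm : 1 ≤ s / 2 := by linarith
  have hbern : ∀ z w : Circle,
      1 + s / 2 * (1 + 2 * circleInner z w) ≤ (2 + 2 * circleInner z w) ^ (s / 2) := fun z w => by
    have h1 := neg_one_le_circleInner z w
    have h2 := one_add_mul_sub_one_le_rpow (t := 2 + 2 * circleInner z w) (by linarith) hm
    linarith
  have hpos : 0 < s / 2 * (3 + 2 * (circleInner A B + circleInner B C + circleInner C A)) :=
    mul_pos (by linarith) (by linarith)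
  have h1 := hbern A B
  have h2 := hbern B C
  have h3 := hbern C A
  by_contra! hcon
  have hA := hcon (-A)
  have hB := hcon (-B)
  have hC := hcon (-C)
  rw [powerSum_eq_chordSq, two_rpow_eq] at hA hB hC
  simp only [chordSq_neg_self, chordSq_neg_left, circleInner_comm B A, circleInner_comm A C,
    circleInner_comm C B] at hA hB hC
  linarith

lemma four_add_rpow_gt {x y m : ℝ} (hx : 0 ≤ x) (hy : 0 ≤ y) (hxy : 4 ≤ x + y) (h1 : 1 ≤ m)
    (h2 : m ≤ 2) : 2 * (3 : ℝ) ^ m < 4 ^ m + x ^ m + y ^ m := by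
  rw [rpow_eq_three_rpow_mul hx, rpow_eq_three_rpow_mul hy,
    rpow_eq_three_rpow_mul (show (0 : ℝ) ≤ 4 by norm_num)]
  have e1 := one_add_mul_sub_one_le_rpow (t := x / 3) (by positivity) h1
  have e2 := one_add_mul_sub_one_le_rpow (t := y / 3) (by positivity) h1
  have e3 := one_add_mul_sub_one_le_rpow (t := 4 / 3) (by positivity) h1
  have h3 : 0 < (3 : ℝ) ^ m := by positivity
  have h4 : 2 < (4 / 3 : ℝ) ^ m + (x / 3) ^ m + (y / 3) ^ m := by
    have := mul_nonneg (show (0 : ℝ) ≤ m by linarith) (sub_nonneg.2 hxy)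
    linarith
  nlinarith

lemma two_mul_three_rpow_lt {x y m : ℝ} (hx : 0 ≤ x) (hy : 0 ≤ y) (hxy : 6 ≤ x + y)
    (hne : ¬(x = 3 ∧ y = 3)) (h1 : 1 < m) : 2 * (3 : ℝ) ^ m < x ^ m + y ^ m := by
  rw [rpow_eq_three_rpow_mul hx, rpow_eq_three_rpow_mul hy]
  have h3 : 0 < (3 : ℝ) ^ m := by positivity
  have hm := mul_nonneg (show (0 : ℝ) ≤ m by linarith) (sub_nonneg.2 hxy)
  have h4 : 2 < (x / 3) ^ m + (y / 3) ^ m := by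
    by_cases hx3 : x = 3
    · have e1 := one_add_mul_sub_one_le_rpow (t := x / 3) (by positivity) h1.le
      have e2 := one_add_mul_sub_one_lt_rpow (t := y / 3) (by positivity)
        (fun h => hne ⟨hx3, by linarith⟩) h1
      linarith
    · have e1 := one_add_mul_sub_one_lt_rpow (t := x / 3) (by positivity)
        (fun h => hx3 (by linarith)) h1
      have e2 := one_add_mul_sub_one_le_rpow (t := y / 3) (by positivity) h1.le
      linarith
  nlinarith

/-- Here `p ≥ q ≥ r` are the pairwise inner products of three unit vectors of the plane. The
conclusion says that the vector common to `q` and `r` has nonpositive inner product with the sum of the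
three vectors. -/
lemma add_le_neg_one_of_gram {p q r : ℝ} (hr : -1 ≤ r) (hqp : q ≤ p) (hrq : r ≤ q)
    (hpq : p + q < 0) (hg : 1 + 2 * p * q * r - p ^ 2 - q ^ 2 - r ^ 2 = 0) : q + r ≤ -1 := by
  by_contra! h
  have hq : q < 0 := by linarith
  -- The Gram determinant is a concave function of `p`, positive at both ends of `[q, -q]`.
  have h1 : 0 < (1 - r) * (1 + r - 2 * q ^ 2) := mul_pos (by linarith) (by nlinarith)
  have h2 : 0 < (1 + r) * (1 - r - 2 * q ^ 2) := mul_pos (by linarith) (by nlinarith)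
  have h3 : 0 ≤ (p - q) * (-q - p) := mul_nonneg (by linarith) (by linarith)
  nlinarith

/-- The bound is exceeded at the antipode of `A` if `⟪A, B⟫ + ⟪A, C⟫ ≥ 0`, and at `A` itself if
`⟪A, B⟫ + ⟪A, C⟫ ≤ -1`, unless `⟪A, B⟫ = ⟪A, C⟫ = -1/2`. In that exceptional case the triple
is equilateral or `B = C`, and if `B = C`, then the first criterion applies to `B`. Some naming of the
points satisfies one of the two criteria. Here `⟪A, B⟫` is `circleInner A B`. -/
lemma exists_sqrt_three_lt_powerSum {A B C : Circle} (h : (A : ℂ) + B + C ≠ 0) {s : ℝ} (h2 : 2 < s)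
    (h4 : s < 4) : ∃ M : Circle, 2 * Real.sqrt 3 ^ s < powerSum A B C M s := by
  have hanti : ∀ {A B C : Circle}, 0 ≤ circleInner A B + circleInner C A →
      ∃ M : Circle, 2 * Real.sqrt 3 ^ s < powerSum A B C M s := fun {A B C} h => by
    refine ⟨-A, ?_⟩
    rw [powerSum_eq_chordSq, sqrt_three_rpow_eq, chordSq_neg_self]
    refine four_add_rpow_gt (chordSq_nonneg _ _) (chordSq_nonneg _ _) ?_ (by linarith) (by linarith)
    rw [chordSq_neg_left, chordSq_neg_left, circleInner_comm A C]
    linarith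
  have hvert : ∀ {A B C : Circle}, (A : ℂ) + B + C ≠ 0 → circleInner A B + circleInner B C < 0 →
      circleInner A B + circleInner C A ≤ -1 →
      ∃ M : Circle, 2 * Real.sqrt 3 ^ s < powerSum A B C M s := fun {A B C} h hB hA => by
    refine ⟨A, ?_⟩
    have hAA : chordSq A A = 0 := by rw [chordSq, circleInner_self]; ring
    rw [powerSum_eq_chordSq, sqrt_three_rpow_eq, hAA, Real.zero_rpow (by linarith), zero_add]
    refine two_mul_three_rpow_lt (chordSq_nonneg _ _) (chordSq_nonneg _ _) ?_ ?_ (by linarith)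
    · rw [chordSq, chordSq, circleInner_comm A C]
      linarith
    · rintro ⟨hx, hy⟩
      rw [chordSq] at hx hy
      rw [circleInner_comm A C] at hy
      have hAB : circleInner A B = -1 / 2 := by linarith
      have hCA : circleInner C A = -1 / 2 := by linarith
      have hg := gram_det_eq_zero A B C
      rw [hAB] at hB
      rw [hAB, hCA] at hg
      -- The remaining inner product is `1` or `-1/2`, and `1` is excluded by `hB`.
      have h0 : (circleInner B C - 1) * (circleInner B C + 1 / 2) = 0 := by
        linear_combination -hg
      have hBC := (mul_eq_zero.1 h0).resolve_left (by linarith)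
      exact h ((sum_eq_zero_iff_circleInner A B C).2 (by linarith))
  have hrot : ∀ {A B C : Circle}, (∃ M : Circle, 2 * Real.sqrt 3 ^ s < powerSum B C A M s) →
      ∃ M : Circle, 2 * Real.sqrt 3 ^ s < powerSum A B C M s := fun ⟨M, hM⟩ =>
    ⟨M, by rwa [powerSum_rotate] at hM⟩
  rcases le_or_gt 0 (circleInner A B + circleInner C A) with hA | hA
  · exact hanti hA
  rcases le_or_gt 0 (circleInner B C + circleInner A B) with hB | hB
  · exact hrot (hanti hB)
  rcases le_or_gt 0 (circleInner C A + circleInner B C) with hC | hC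
  · exact hrot (hrot (hanti hC))
  have hg := gram_det_eq_zero A B C
  have b1 := neg_one_le_circleInner A B
  have b2 := neg_one_le_circleInner B C
  have b3 := neg_one_le_circleInner C A
  have hsome : circleInner A B + circleInner C A ≤ -1 ∨ circleInner B C + circleInner A B ≤ -1 ∨
      circleInner C A + circleInner B C ≤ -1 := by
    generalize circleInner A B = x at *
    generalize circleInner B C = y at *
    generalize circleInner C A = z at *
    by_contra! hcon
    obtain ⟨c1, c2, c3⟩ := hcon
    rcases le_total x y with k1 | k1 <;> rcases le_total y z with k2 | k2 <;>
      rcases le_total z x with k3 | k3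
    · linarith [add_le_neg_one_of_gram (p := z) (q := y) (r := x) b1 k2 k1 (by linarith)
        (by linarith)]
    · linarith [add_le_neg_one_of_gram (p := z) (q := y) (r := x) b1 k2 k1 (by linarith)
        (by linarith)]
    · linarith [add_le_neg_one_of_gram (p := y) (q := x) (r := z) b3 k1 k3 (by linarith)
        (by linarith)]
    · linarith [add_le_neg_one_of_gram (p := y) (q := z) (r := x) b1 k2 k3 (by linarith)
        (by linarith)]
    · linarith [add_le_neg_one_of_gram (p := x) (q := z) (r := y) b2 k3 k2 (by linarith)
        (by linarith)]
    · linarith [add_le_neg_one_of_gram (p := z) (q := x) (r := y) b2 k3 k1 (by linarith)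
        (by linarith)]
    · linarith [add_le_neg_one_of_gram (p := x) (q := y) (r := z) b3 k1 k2 (by linarith)
        (by linarith)]
    · linarith [add_le_neg_one_of_gram (p := x) (q := y) (r := z) b3 k1 k2 (by linarith)
        (by linarith)]
  have hr1 : (B : ℂ) + C + A ≠ 0 := fun h' => h (sum_rotate (sum_rotate h'))
  have hr2 : (C : ℂ) + A + B ≠ 0 := fun h' => h (sum_rotate h')
  rcases hsome with k | k | k
  · exact hvert h (by linarith) k
  · exact hrot (hvert hr1 (by linarith) k)
  · exact hrot (hrot (hvert hr2 (by linarith) k))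

/-! ### Existence of the extrema -/

lemma exists_isGreatest_valuesOnCircle (A B C : Circle) {s : ℝ} (hs : 0 ≤ s) :
    ∃ m : ℝ, IsGreatest (valuesOnCircle A B C s) m := by
  have hc : Continuous fun M : Circle => powerSum A B C M s := by
    have : ∀ z : Circle, Continuous fun M : Circle => dist (M : ℂ) (z : ℂ) ^ s := fun z =>
      (show Continuous fun M : Circle => dist (M : ℂ) (z : ℂ) by fun_prop).rpow_const
        fun _ => Or.inr hs
    exact ((this A).add (this B)).add (this C)
  obtain ⟨M, -, hM⟩ := isCompact_univ.exists_isMaxOn ⟨A, Set.mem_univ A⟩ hc.continuousOn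
  refine ⟨_, ⟨M, rfl⟩, ?_⟩
  rintro _ ⟨N, rfl⟩
  exact hM (Set.mem_univ N)

/-- For `s < 0` the sum is large near `A`, `B` and `C`, so that a minimum over a compact set of points
bounded away from these three is a minimum over all points. -/
lemma exists_isLeast_valuesOffPoints (A B C : Circle) {s : ℝ} (hs : s < 0)
    (hne : ∃ M : Circle, M ≠ A ∧ M ≠ B ∧ M ≠ C) :
    ∃ m : ℝ, IsLeast (valuesOffPoints A B C s) m := by
  obtain ⟨M₀, hA, hB, hC⟩ := hne
  have hpos : ∀ {M z : Circle}, M ≠ z → 0 < dist (M : ℂ) (z : ℂ) := fun h =>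
    dist_pos.2 fun h' => h (Circle.ext h')
  set K := powerSum A B C M₀ s with hK
  have hK0 : 0 < K := by
    have h1 := Real.rpow_pos_of_pos (hpos hA) s
    have h2 := Real.rpow_pos_of_pos (hpos hB) s
    have h3 := Real.rpow_pos_of_pos (hpos hC) s
    rw [hK, powerSum]
    linarith
  set δ := K ^ s⁻¹ with hδ
  have hδ0 : 0 < δ := Real.rpow_pos_of_pos hK0 _
  have hδs : δ ^ s = K := Real.rpow_inv_rpow hK0.le hs.ne
  set T : Set Circle := {M | δ ≤ dist (M : ℂ) (A : ℂ) ∧ δ ≤ dist (M : ℂ) (B : ℂ) ∧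
    δ ≤ dist (M : ℂ) (C : ℂ)} with hT
  have hcd : ∀ z : Circle, Continuous fun M : Circle => dist (M : ℂ) (z : ℂ) := fun z => by
    fun_prop
  have hTc : IsCompact T :=
    ((isClosed_le continuous_const (hcd A)).inter ((isClosed_le continuous_const (hcd B)).inter
      (isClosed_le continuous_const (hcd C)))).isCompact
  have hmem : ∀ {M : Circle}, M ≠ A → M ≠ B → M ≠ C → powerSum A B C M s ≤ K → M ∈ T := by
    intro M hA hB hC hM
    have h1 := Real.rpow_pos_of_pos (hpos hA) s
    have h2 := Real.rpow_pos_of_pos (hpos hB) s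
    have h3 := Real.rpow_pos_of_pos (hpos hC) s
    rw [powerSum, ← hδs] at hM
    exact ⟨(Real.rpow_le_rpow_iff_of_neg (hpos hA) hδ0 hs).1 (by linarith),
      (Real.rpow_le_rpow_iff_of_neg (hpos hB) hδ0 hs).1 (by linarith),
      (Real.rpow_le_rpow_iff_of_neg (hpos hC) hδ0 hs).1 (by linarith)⟩
  have hcont : ContinuousOn (fun M : Circle => powerSum A B C M s) T :=
    (((hcd A).continuousOn.rpow_const fun M hM => Or.inl (hδ0.trans_le hM.1).ne').add
      ((hcd B).continuousOn.rpow_const fun M hM => Or.inl (hδ0.trans_le hM.2.1).ne')).add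
      ((hcd C).continuousOn.rpow_const fun M hM => Or.inl (hδ0.trans_le hM.2.2).ne')
  have hM₀ : M₀ ∈ T := hmem hA hB hC le_rfl
  obtain ⟨M, hMT, hM⟩ := hTc.exists_isMinOn ⟨M₀, hM₀⟩ hcont
  have hT_ne : ∀ z : Circle, δ ≤ dist (M : ℂ) (z : ℂ) → M ≠ z := by
    rintro z hz rfl
    rw [dist_self] at hz
    linarith
  refine ⟨_, ⟨M, hT_ne A hMT.1, hT_ne B hMT.2.1, hT_ne C hMT.2.2, rfl⟩, ?_⟩
  rintro _ ⟨N, hNA, hNB, hNC, rfl⟩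
  rcases le_total (powerSum A B C N s) K with h | h
  · exact hM (hmem hNA hNB hNC h)
  · exact le_trans (hM hM₀) h

/-! ### The minimax statements -/

/-- The results for maxima follow once `v` is the maximum for the triples with sum zero and is
exceeded for all others. -/
lemma minMax_of_sum_eq_zero_of_sum_ne_zero {s v : ℝ} (hs : 0 ≤ s)
    (hE : ∀ A B C : Circle, (A : ℂ) + B + C = 0 → IsGreatest (valuesOnCircle A B C s) v)
    (hN : ∀ A B C : Circle, (A : ℂ) + B + C ≠ 0 → ∃ M : Circle, v < powerSum A B C M s) :
    (∀ A B C : Circle, (∃ M : Circle, v ≤ powerSum A B C M s) ∧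
      (IsGreatest (valuesOnCircle A B C s) v ↔ IsEquilateralTriple A B C)) ∧ MinMaxEq s v := by
  have hex : ∀ A B C : Circle, ∃ M : Circle, v ≤ powerSum A B C M s := fun A B C => by
    by_cases h : (A : ℂ) + B + C = 0
    · obtain ⟨M, hM⟩ := (hE A B C h).1
      exact ⟨M, hM.ge⟩
    · exact (hN A B C h).imp fun M hM => hM.le
  refine ⟨fun A B C => ⟨hex A B C, ?_⟩,
    fun A B C => exists_isGreatest_valuesOnCircle A B C hs, ?_, ?_⟩
  · rw [isEquilateralTriple_iff_sum_eq_zero]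
    refine ⟨fun hv => ?_, hE A B C⟩
    by_contra h
    obtain ⟨M, hM⟩ := hN A B C h
    exact (hv.2 ⟨M, rfl⟩).not_gt hM
  · obtain ⟨A, B, C, h⟩ := exists_sum_eq_zero
    exact ⟨A, B, C, hE A B C h⟩
  · rintro m ⟨A, B, C, hm⟩
    obtain ⟨M, hM⟩ := hex A B C
    exact hM.trans (hm.2 ⟨M, rfl⟩)

lemma maxMin_of_neg {s : ℝ} (hs : s < 0) :
    (∀ A B C : Circle,
      (∃ M : Circle, M ≠ A ∧ M ≠ B ∧ M ≠ C ∧ powerSum A B C M s ≤ 2 + (2 : ℝ) ^ s) ∧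
      (IsLeast (valuesOffPoints A B C s) (2 + (2 : ℝ) ^ s) ↔ IsEquilateralTriple A B C)) ∧
      MaxMinEq s (2 + (2 : ℝ) ^ s) := by
  have hex : ∀ A B C : Circle,
      ∃ M : Circle, M ≠ A ∧ M ≠ B ∧ M ≠ C ∧ powerSum A B C M s ≤ 2 + (2 : ℝ) ^ s := fun A B C => by
    by_cases h : (A : ℂ) + B + C = 0
    · obtain ⟨M, hA, hB, hC, hM⟩ := (isLeast_of_sum_eq_zero h hs).1
      exact ⟨M, hA, hB, hC, hM.le⟩
    · obtain ⟨M, hA, hB, hC, hM⟩ := exists_powerSum_lt_of_neg h hs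
      exact ⟨M, hA, hB, hC, hM.le⟩
  refine ⟨fun A B C => ⟨hex A B C, ?_⟩, fun A B C => ?_, ?_, ?_⟩
  · rw [isEquilateralTriple_iff_sum_eq_zero]
    refine ⟨fun hv => ?_, fun h => isLeast_of_sum_eq_zero h hs⟩
    by_contra h
    obtain ⟨M, hA, hB, hC, hM⟩ := exists_powerSum_lt_of_neg h hs
    exact (hv.2 ⟨M, hA, hB, hC, rfl⟩).not_gt hM
  · exact exists_isLeast_valuesOffPoints A B C hs
      ((hex A B C).imp fun M hM => ⟨hM.1, hM.2.1, hM.2.2.1⟩)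
  · obtain ⟨A, B, C, h⟩ := exists_sum_eq_zero
    exact ⟨A, B, C, isLeast_of_sum_eq_zero h hs⟩
  · rintro m ⟨A, B, C, hm⟩
    obtain ⟨M, hA, hB, hC, hM⟩ := hex A B C
    exact (hm.2 ⟨M, hA, hB, hC, rfl⟩).trans hM

/-- For `s = 0` the sum is constant, since `0 ^ 0 = 1`. -/
lemma isGreatest_valuesOnCircle_zero (A B C : Circle) :
    IsGreatest (valuesOnCircle A B C 0) (2 + 2 ^ (0 : ℝ)) := by
  constructor
  · exact ⟨A, by norm_num [powerSum]⟩
  · rintro _ ⟨M, rfl⟩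
    norm_num [powerSum]

theorem theorem1 (s : ℝ) :
    (s < 0 →
      (∀ A B C : Circle,
        (∃ M : Circle, M ≠ A ∧ M ≠ B ∧ M ≠ C ∧ powerSum A B C M s ≤ 2 + (2 : ℝ) ^ s) ∧
        (IsLeast (valuesOffPoints A B C s) (2 + (2 : ℝ) ^ s) ↔ IsEquilateralTriple A B C)) ∧
      MaxMinEq s (2 + (2 : ℝ) ^ s)) ∧
    (0 ≤ s ∧ s ≤ 2 →
      (∀ A B C : Circle,
        (∃ M : Circle, 2 + (2 : ℝ) ^ s ≤ powerSum A B C M s) ∧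
        (IsGreatest (valuesOnCircle A B C s) (2 + (2 : ℝ) ^ s) ↔
          s = 0 ∨ IsEquilateralTriple A B C)) ∧
      MinMaxEq s (2 + (2 : ℝ) ^ s)) ∧
    (2 < s ∧ s < 4 →
      (∀ A B C : Circle,
        (∃ M : Circle, 2 * (Real.sqrt 3) ^ s ≤ powerSum A B C M s) ∧
        (IsGreatest (valuesOnCircle A B C s) (2 * (Real.sqrt 3) ^ s) ↔ IsEquilateralTriple A B C)) ∧
      MinMaxEq s (2 * (Real.sqrt 3) ^ s)) ∧
    (4 ≤ s →
      (∀ A B C : Circle,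
        (∃ M : Circle, 2 + (2 : ℝ) ^ s ≤ powerSum A B C M s) ∧
        (IsGreatest (valuesOnCircle A B C s) (2 + (2 : ℝ) ^ s) ↔ IsEquilateralTriple A B C)) ∧
      MinMaxEq s (2 + (2 : ℝ) ^ s)) := by
  refine ⟨maxMin_of_neg, ?_, ?_, ?_⟩
  · rintro ⟨h0, h2⟩
    rcases h0.eq_or_lt with rfl | h0
    · have hz := isGreatest_valuesOnCircle_zero
      refine ⟨fun A B C => ⟨(hz A B C).1.imp fun M hM => hM.ge, fun _ => Or.inl rfl,
        fun _ => hz A B C⟩, fun A B C => ⟨_, hz A B C⟩, ⟨1, 1, 1, hz 1 1 1⟩, ?_⟩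
      rintro m ⟨A, B, C, hm⟩
      exact ((hz A B C).unique hm).le
    · simp only [h0.ne', false_or]
      refine minMax_of_sum_eq_zero_of_sum_ne_zero h0.le
        (fun A B C h => isGreatest_of_sum_eq_zero h h0 (Or.inl h2)) fun A B C h => ?_
      rcases h2.eq_or_lt with rfl | h2
      · exact exists_lt_powerSum_of_two_le h le_rfl
      · exact exists_lt_powerSum_of_lt_two h h0 h2
  · rintro ⟨h2, h4⟩
    exact minMax_of_sum_eq_zero_of_sum_ne_zero (by linarith)
      (fun A B C h => isGreatest_sqrt_three_of_sum_eq_zero h h2.le h4.le)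
      fun A B C h => exists_sqrt_three_lt_powerSum h h2 h4
  · intro h4
    exact minMax_of_sum_eq_zero_of_sum_ne_zero (by linarith)
      (fun A B C h => isGreatest_of_sum_eq_zero h (by linarith) (Or.inr h4))
      fun A B C h => exists_lt_powerSum_of_two_le h (by linarith)
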